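/- **Setting.** Let $d\in\{2,3\}$ and let $\Omega\subset\mathbb R^d$ be a bounded polyhedral domain (connected, open, equal to the interior of its closure), $\Gamma_D\subset\partial\Omega$, and let $\Omega_1,\dots,\Omega_M\subset\Omega$ be disjoint nonempty open polyhedral subdomains (each equal to the interior of its closure) with $\overline\Omega=\bigcup_m\overline{\Omega}_m$. Let $\omega_m>0$ and $\rho_m\ge 0$ be constants on $\Omega_m$, and assume that $\rho\not\equiv0$ or that $\Gamma_D$ has positive $(d-1)$-dimensional measure. Put $$a(u,v)=\sum_{m=1}^M\Big(\omega_m\int_{\Omega_m}\nabla u\cdot\nabla v\,dx+\rho_m\int_{\Omega_m}uv\,dx\Big),\qquad \|u\|_{0,\tau}^2=\sum_{m=1}^M\tau_m\|u\|_{L^2(\Omega_m)}^2 .$$ Let $\mathcal T_0,\dots,\mathcal T_L$ be conforming simplicial triangulations of $\overline\Omega$, each refining the preceding one, such that every $\overline\Omega_m$ is a union of cells of $\mathcal T_0$. Let $h_k$ be the largest diameter of a cell of $\mathcal T_k$, and $h=h_L$. Assume that, for constants $\gamma,\eta\in(0,1)$ and $\kappa\ge1$, every cell of $\mathcal T_k$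 contains a ball of radius $h_k/\kappa$, that $\kappa^{-1}\gamma^kh_0\le h_k\le\kappa\gamma^kh_0$ for $0\le k\le L$, that $h_0\le\kappa$, and that $h\le\eta$. Let $V_k$ be the space of continuous functions on $\overline\Omega$ that are affine on each cell of $\mathcal T_k$ and have vanishing trace on $\Gamma_D$; let $V_h=V_L$, let $(\cdot,\cdot)$ be the $L^2(\Omega)$ inner product, $Q_k:V_h\to V_k$ the $L^2$ projection, and define $A_k:V_k\to V_k$ by $(A_kw,v)=a(w,v)$ for all $w,v\in V_k$; let $A=A_L$. Let $R_0=A_0^{-1}$ and, for $1\le k\le L$, let $R_k:V_k\to V_k$ be symmetric positive definite with $$c^{-1}h_k^{-2}\|u\|_{0,\omega+h_k^2\rho}^2\le (R_k^{-1}u,u)\le c\,h_k^{-2}\|u\|_{0,\omega+h_k^2\rho}^2\qquad\text{for all }u\in V_k,$$ where $c\ge1$ is a constant. The BPX preconditioner is $B=\sum_{k=0}^LR_kQ_k:V_h\to V_h$. **Lemma.** $B$ is invertible, and there is a constant $C>0$ depending only on $d,\gamma,\kappa,c,\eta$ (in particular, not on $h$, $L$, $\omega$, $\rho$) such that $$(Au,u)\le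 C\,|\log h|\,(B^{-1}u,u)\qquad\text{for all }u\in V_h .$$ Hence, if $V_h\ne\{0\}$, the operator $BA$ has a largest real eigenvalue $\lambda_{\max}(BA)$, and $\lambda_{\max}(BA)\le C\,|\log h|$. -/

import Mathlib

open MeasureTheory Set
open scoped Gradient

noncomputable section

namespace BPX

/-- Euclidean space of dimension `d`. -/
abbrev Pt (d : ℕ) : Type := EuclideanSpace ℝ (Fin d)

/-- A domain: a connected (in particular nonempty) open set without cracks, that is, equal to the
interior of its closure.  It is bounded and polyhedral as soon as it carries a `Triangulation`. -/
structure PolyDomain (d : ℕ) where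
  carrier : Set (Pt d)
  isOpen : IsOpen carrier
  isConnected : IsConnected carrier
  regular : interior (closure carrier) = carrier

/-- A decomposition of the domain into `M` non-overlapping nonempty open subdomains
whose closures cover the closure of the domain. -/
structure Subdomains {d : ℕ} (Ω : PolyDomain d) (M : ℕ) where
  dom : Fin M → Set (Pt d)
  isOpen : ∀ m, IsOpen (dom m)
  nonempty : ∀ m, (dom m).Nonempty
  regular : ∀ m, interior (closure (dom m)) = dom m
  disjoint : ∀ m n, m ≠ n → Disjoint (dom m) (dom n)
  cover : ⋃ m, closure (dom m) = closure Ω.carrier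

/-- A conforming simplicial triangulation of the closure of the domain.  A cell is given by the
finite set of its `d + 1` affinely independent vertices; two cells meet exactly in the simplex
spanned by their common vertices. -/
structure Triangulation {d : ℕ} (Ω : PolyDomain d) where
  cells : Finset (Finset (Pt d))
  card_cell : ∀ s ∈ cells, s.card = d + 1
  indep : ∀ s ∈ cells, AffineIndependent ℝ ((↑) : s → Pt d)
  conforming : ∀ s ∈ cells, ∀ t ∈ cells,
    convexHull ℝ (s : Set (Pt d)) ∩ convexHull ℝ (t : Set (Pt d)) =
      convexHull ℝ ((s : Set (Pt d)) ∩ (t : Set (Pt d)))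
  cover : ⋃ s ∈ cells, convexHull ℝ (s : Set (Pt d)) = closure Ω.carrier

variable {d : ℕ} {Ω : PolyDomain d}

namespace Triangulation

/-- The mesh size: the largest diameter of a cell. -/
def meshSize (T : Triangulation Ω) : ℝ :=
  ⨆ s : T.cells, Metric.diam (convexHull ℝ ((s : Finset (Pt d)) : Set (Pt d)))

/-- Every cell (of diameter at most `meshSize`) contains a ball of radius `meshSize / κ`. -/
def QuasiUniform (T : Triangulation Ω) (κ : ℝ) : Prop :=
  ∀ s ∈ T.cells, ∃ x, Metric.closedBall x (T.meshSize / κ) ⊆ convexHull ℝ (s : Set (Pt d))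

/-- Every cell of `T` lies in a cell of `T₀`. -/
def Refines (T T₀ : Triangulation Ω) : Prop :=
  ∀ s ∈ T.cells, ∃ t ∈ T₀.cells,
    convexHull ℝ (s : Set (Pt d)) ⊆ convexHull ℝ (t : Set (Pt d))

/-- The subdomains are resolved exactly by the mesh. -/
def Resolves (T : Triangulation Ω) {M : ℕ} (D : Subdomains Ω M) : Prop :=
  ∀ m, ∃ S ⊆ T.cells, closure (D.dom m) = ⋃ s ∈ S, convexHull ℝ (s : Set (Pt d))

/-- The linear Lagrange finite element space: functions that are continuous on the closed domain,
affine on every cell, and whose trace (boundary value) vanishes almost everywhere on `ΓD` for the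
`(d - 1)`-dimensional surface measure.  Functions live on the closed domain; as functions on all
of space they are extended by zero. -/
def feSpace (T : Triangulation Ω) (ΓD : Set (Pt d)) : Submodule ℝ (Pt d → ℝ) where
  carrier := {v | ContinuousOn v (closure Ω.carrier) ∧
    (∀ s ∈ T.cells, ∃ g : Pt d →ᵃ[ℝ] ℝ, EqOn v g (convexHull ℝ (s : Set (Pt d)))) ∧
    (∀ᵐ x ∂((Measure.hausdorffMeasure ((d : ℝ) - 1)).restrict ΓD), v x = 0) ∧
    ∀ x ∉ closure Ω.carrier, v x = 0}
  zero_mem' := ⟨continuousOn_const, fun _ _ => ⟨0, fun _ _ => rfl⟩,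
    Filter.Eventually.of_forall fun _ => rfl, fun _ _ => rfl⟩
  add_mem' := by
    rintro u v ⟨hu1, hu2, hu3, hu4⟩ ⟨hv1, hv2, hv3, hv4⟩
    refine ⟨hu1.add hv1, fun s hs => ?_, ?_, fun x hx => ?_⟩
    · obtain ⟨g, hg⟩ := hu2 s hs
      obtain ⟨k, hk⟩ := hv2 s hs
      exact ⟨g + k, fun x hx => by simp [hg hx, hk hx]⟩
    · filter_upwards [hu3, hv3] with x hx hx2
      simp [hx, hx2]
    · simp [hu4 x hx, hv4 x hx]
  smul_mem' := by
    rintro c u ⟨hu1, hu2, hu3, hu4⟩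
    refine ⟨hu1.const_smul c, fun s hs => ?_, ?_, fun x hx => ?_⟩
    · obtain ⟨g, hg⟩ := hu2 s hs
      exact ⟨c • g, fun x hx => by simp [hg hx]⟩
    · filter_upwards [hu3] with x hx
      simp [hx]
    · simp [hu4 x hx]

lemma feSpace_mono {T T₀ : Triangulation Ω} (h : T.Refines T₀) (ΓD : Set (Pt d)) :
    T₀.feSpace ΓD ≤ T.feSpace ΓD := by
  rintro v ⟨h1, h2, h3, h4⟩
  refine ⟨h1, fun s hs => ?_, h3, h4⟩
  obtain ⟨t, ht, hst⟩ := h s hs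
  obtain ⟨g, hg⟩ := h2 t ht
  exact ⟨g, hg.mono hst⟩

lemma isCompact_closure (T : Triangulation Ω) : IsCompact (closure Ω.carrier) := by
  rw [← T.cover]
  exact T.cells.isCompact_biUnion fun s _ => s.finite_toSet.isCompact_convexHull ℝ

instance (T : Triangulation Ω) (ΓD : Set (Pt d)) : FiniteDimensional ℝ (T.feSpace ΓD) := by
  let W : Finset (Pt d) := T.cells.biUnion id
  let f : T.feSpace ΓD →ₗ[ℝ] (W → ℝ) :=
    { toFun := fun v x => (v : Pt d → ℝ) x
      map_add' := fun _ _ => rfl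
      map_smul' := fun _ _ => rfl }
  refine FiniteDimensional.of_injective f ((injective_iff_map_eq_zero f).2 fun v hv => ?_)
  obtain ⟨v, h1, h2, h3, h4⟩ := v
  ext x
  change v x = 0
  by_cases hx : x ∈ closure Ω.carrier
  · rw [← T.cover] at hx
    simp only [mem_iUnion] at hx
    obtain ⟨s, hs, hxs⟩ := hx
    obtain ⟨g, hg⟩ := h2 s hs
    have hsub : (s : Set (Pt d)) ⊆ {y | g y = 0} := by
      intro y hy
      have hyW : y ∈ W := Finset.mem_biUnion.2 ⟨s, hs, hy⟩
      have := congrFun hv ⟨y, hyW⟩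
      change v y = 0 at this
      rw [hg (subset_convexHull ℝ _ hy)] at this
      exact this
    have hconv : Convex ℝ {y | g y = 0} := by
      have := (convex_singleton (𝕜 := ℝ) (0 : ℝ)).affine_preimage g
      exact this
    rw [hg hxs]
    exact convexHull_min hsub hconv hxs
  · exact h4 x hx

variable (T : Triangulation Ω) (ΓD : Set (Pt d))

lemma integrableOn_mul (u v : T.feSpace ΓD) {s : Set (Pt d)} (hs : s ⊆ closure Ω.carrier) :
    IntegrableOn (fun x => u.1 x * v.1 x) s :=
  ((u.2.1.mul v.2.1).integrableOn_compact T.isCompact_closure).mono_set hs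

/-- The `L²` inner product on the finite element space. -/
def massForm : LinearMap.BilinForm ℝ (T.feSpace ΓD) :=
  LinearMap.mk₂ ℝ (fun u v => ∫ x in Ω.carrier, u.1 x * v.1 x)
    (fun u u₂ v => by
      rw [← integral_add (T.integrableOn_mul ΓD u v subset_closure)
        (T.integrableOn_mul ΓD u₂ v subset_closure)]
      exact integral_congr_ae (.of_forall fun x => add_mul (u.1 x) (u₂.1 x) (v.1 x)))
    (fun c u v => by
      rw [smul_eq_mul, ← integral_const_mul]
      exact integral_congr_ae (.of_forall fun x => mul_assoc c (u.1 x) (v.1 x)))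
    (fun u v v₂ => by
      rw [← integral_add (T.integrableOn_mul ΓD u v subset_closure)
        (T.integrableOn_mul ΓD u v₂ subset_closure)]
      exact integral_congr_ae (.of_forall fun x => mul_add (u.1 x) (v.1 x) (v₂.1 x)))
    (fun c u v => by
      rw [smul_eq_mul, ← integral_const_mul]
      exact integral_congr_ae (.of_forall fun x => mul_left_comm (u.1 x) c (v.1 x)))

lemma massForm_self_eq_zero (u : T.feSpace ΓD) (h : T.massForm ΓD u u = 0) : u = 0 := by
  change ∫ x in Ω.carrier, u.1 x * u.1 x = 0 at h
  rw [setIntegral_eq_zero_iff_of_nonneg_ae (.of_forall fun x => mul_self_nonneg _)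
    (T.integrableOn_mul ΓD u u subset_closure)] at h
  have h0 : EqOn (fun x => u.1 x * u.1 x) 0 Ω.carrier :=
    Measure.eqOn_open_of_ae_eq h Ω.isOpen
      ((u.2.1.mul u.2.1).mono subset_closure) continuousOn_const
  ext x
  change u.1 x = 0
  by_cases hx : x ∈ closure Ω.carrier
  · have : EqOn u.1 0 (closure Ω.carrier) := by
      refine EqOn.of_subset_closure (s := Ω.carrier) (fun y hy => ?_) u.2.1 continuousOn_const
        subset_closure le_rfl
      exact mul_self_eq_zero.1 (h0 hy)
    exact this hx
  · exact u.2.2.2.2 x hx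

lemma massForm_nondegenerate : (T.massForm ΓD).Nondegenerate :=
  ⟨fun u hu => T.massForm_self_eq_zero ΓD u (hu u),
    fun u hu => T.massForm_self_eq_zero ΓD u (hu u)⟩

lemma feSpace_ae_gradient (u : T.feSpace ΓD) :
    ∃ K : ℝ, ∀ᵐ x ∂(volume.restrict (closure Ω.carrier)),
      DifferentiableAt ℝ u.1 x ∧ ‖∇ u.1 x‖ ≤ K := by
  choose! g hg using u.2.2.1
  refine ⟨∑ s ∈ T.cells, ‖∇ (g s) 0‖, ?_⟩
  have hfr : ∀ᵐ x : Pt d, ∀ s ∈ T.cells, x ∉ frontier (convexHull ℝ (s : Set (Pt d))) := by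
    rw [Finset.eventually_all]
    intro s _
    exact measure_eq_zero_iff_ae_notMem.1 ((convex_convexHull ℝ _).addHaar_frontier _)
  rw [ae_restrict_iff' isClosed_closure.measurableSet]
  filter_upwards [hfr] with x hx hxΩ
  rw [← T.cover] at hxΩ
  simp only [mem_iUnion] at hxΩ
  obtain ⟨s, hs, hxs⟩ := hxΩ
  have hint : x ∈ interior (convexHull ℝ (s : Set (Pt d))) := by
    by_contra hcon
    exact hx s hs ⟨subset_closure hxs, hcon⟩
  have hev : u.1 =ᶠ[nhds x] g s :=
    Filter.eventuallyEq_of_mem (mem_interior_iff_mem_nhds.1 hint) (hg s hs)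
  have hder : ∀ y, HasFDerivAt (g s) (LinearMap.toContinuousLinearMap (g s).linear) y := by
    intro y
    have h1 : HasFDerivAt (fun z => LinearMap.toContinuousLinearMap (g s).linear z + g s 0)
        (LinearMap.toContinuousLinearMap (g s).linear) y :=
      (ContinuousLinearMap.hasFDerivAt _).add_const _
    refine h1.congr_of_eventuallyEq (.of_forall fun z => ?_)
    have := congrFun (g s).decomp z
    simpa using this
  refine ⟨(hder x).differentiableAt.congr_of_eventuallyEq hev, ?_⟩
  have hgr : ∇ u.1 x = ∇ (g s) 0 := by
    unfold gradient
    rw [hev.fderiv_eq, (hder x).fderiv, (hder 0).fderiv]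
  rw [hgr]
  exact Finset.single_le_sum (f := fun s => ‖∇ (g s) 0‖) (fun _ _ => norm_nonneg _) hs

lemma ae_gradient_add (u v : T.feSpace ΓD) {s : Set (Pt d)} (hs : s ⊆ closure Ω.carrier) :
    ∀ᵐ x ∂(volume.restrict s), ∇ (u + v).1 x = ∇ u.1 x + ∇ v.1 x := by
  obtain ⟨K, hK⟩ := T.feSpace_ae_gradient ΓD u
  obtain ⟨K₂, hK₂⟩ := T.feSpace_ae_gradient ΓD v
  filter_upwards [ae_restrict_of_ae_restrict_of_subset hs hK,
    ae_restrict_of_ae_restrict_of_subset hs hK₂] with x hx hx2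
  change ∇ (u.1 + v.1) x = _
  unfold gradient
  rw [fderiv_add hx.1 hx2.1, map_add]

lemma gradient_smul (c : ℝ) (u : T.feSpace ΓD) (x : Pt d) :
    ∇ (c • u).1 x = c • ∇ u.1 x := by
  change ∇ (c • u.1) x = _
  unfold gradient
  rw [fderiv_const_smul_field, Pi.smul_apply, map_smulₛₗ]
  simp

lemma integrableOn_gradient (u v : T.feSpace ΓD) {s : Set (Pt d)}
    (hs : s ⊆ closure Ω.carrier) :
    IntegrableOn (fun x => inner ℝ (∇ u.1 x) (∇ v.1 x)) s := by
  have hm : ∀ w : Pt d → ℝ, Measurable (∇ w) := fun w =>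
    ((InnerProductSpace.toDual ℝ (Pt d)).symm.continuous.measurable).comp (measurable_fderiv ℝ w)
  obtain ⟨K, hK⟩ := T.feSpace_ae_gradient ΓD u
  obtain ⟨K₂, hK₂⟩ := T.feSpace_ae_gradient ΓD v
  refine IntegrableOn.mono_set ?_ hs
  refine Measure.integrableOn_of_bounded (M := |K| * |K₂|)
    T.isCompact_closure.measure_lt_top.ne
    ((hm u.1).inner (hm v.1)).aestronglyMeasurable ?_
  filter_upwards [hK, hK₂] with x hx hx2
  refine (norm_inner_le_norm _ _).trans ?_
  exact mul_le_mul (hx.2.trans (le_abs_self _)) (hx2.2.trans (le_abs_self _))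
    (norm_nonneg _) (abs_nonneg _)

end Triangulation

lemma Subdomains.subset {M : ℕ} (D : Subdomains Ω M) (m : Fin M) :
    D.dom m ⊆ closure Ω.carrier := by
  rw [← D.cover]
  exact subset_closure.trans (subset_iUnion (fun m => closure (D.dom m)) m)

/-- The squared weighted norm `‖u‖²_{0,τ} = ∑ₘ τₘ ‖u‖²_{L²(Ωₘ)}`. -/
def weightedL2Sq {M : ℕ} (D : Subdomains Ω M) (τ : Fin M → ℝ) (u : Pt d → ℝ) : ℝ :=
  ∑ m, τ m * ∫ x in D.dom m, u x ^ 2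

namespace Triangulation

variable (T : Triangulation Ω) (ΓD : Set (Pt d)) {M : ℕ} (D : Subdomains Ω M) (ω ρ : Fin M → ℝ)

/-- The energy form `a(u,v) = ∑ₘ (ωₘ ∫_{Ωₘ} ∇u · ∇v + ρₘ ∫_{Ωₘ} u v)`.  Finite element functions
are affine near almost every point of the domain, so the pointwise gradient is the weak one. -/
def energyForm : LinearMap.BilinForm ℝ (T.feSpace ΓD) :=
  LinearMap.mk₂ ℝ (fun u v => ∑ m, (ω m * (∫ x in D.dom m, inner ℝ (∇ u.1 x) (∇ v.1 x)) +
      ρ m * ∫ x in D.dom m, u.1 x * v.1 x))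
    (fun u u₂ v => by
      rw [← Finset.sum_add_distrib]
      refine Finset.sum_congr rfl fun m _ => ?_
      have h1 : ∫ x in D.dom m, inner ℝ (∇ (u + u₂).1 x) (∇ v.1 x) =
          (∫ x in D.dom m, inner ℝ (∇ u.1 x) (∇ v.1 x)) +
            ∫ x in D.dom m, inner ℝ (∇ u₂.1 x) (∇ v.1 x) := by
        rw [← integral_add (T.integrableOn_gradient ΓD u v (D.subset m))
          (T.integrableOn_gradient ΓD u₂ v (D.subset m))]
        refine integral_congr_ae ?_
        filter_upwards [T.ae_gradient_add ΓD u u₂ (D.subset m)] with x hx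
        rw [hx, inner_add_left]
      have h2 : ∫ x in D.dom m, (u + u₂).1 x * v.1 x =
          (∫ x in D.dom m, u.1 x * v.1 x) + ∫ x in D.dom m, u₂.1 x * v.1 x := by
        rw [← integral_add (T.integrableOn_mul ΓD u v (D.subset m))
          (T.integrableOn_mul ΓD u₂ v (D.subset m))]
        exact integral_congr_ae (.of_forall fun x => add_mul (u.1 x) (u₂.1 x) (v.1 x))
      rw [h1, h2]
      ring)
    (fun c u v => by
      rw [smul_eq_mul, Finset.mul_sum]
      refine Finset.sum_congr rfl fun m _ => ?_
      have h1 : ∫ x in D.dom m, inner ℝ (∇ (c • u).1 x) (∇ v.1 x) =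
          c * ∫ x in D.dom m, inner ℝ (∇ u.1 x) (∇ v.1 x) := by
        rw [← integral_const_mul]
        refine integral_congr_ae (.of_forall fun x => ?_)
        simp only [T.gradient_smul ΓD c u x, real_inner_smul_left]
      have h2 : ∫ x in D.dom m, (c • u).1 x * v.1 x = c * ∫ x in D.dom m, u.1 x * v.1 x := by
        rw [← integral_const_mul]
        exact integral_congr_ae (.of_forall fun x => mul_assoc c (u.1 x) (v.1 x))
      rw [h1, h2]
      ring)
    (fun u v v₂ => by
      rw [← Finset.sum_add_distrib]
      refine Finset.sum_congr rfl fun m _ => ?_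
      have h1 : ∫ x in D.dom m, inner ℝ (∇ u.1 x) (∇ (v + v₂).1 x) =
          (∫ x in D.dom m, inner ℝ (∇ u.1 x) (∇ v.1 x)) +
            ∫ x in D.dom m, inner ℝ (∇ u.1 x) (∇ v₂.1 x) := by
        rw [← integral_add (T.integrableOn_gradient ΓD u v (D.subset m))
          (T.integrableOn_gradient ΓD u v₂ (D.subset m))]
        refine integral_congr_ae ?_
        filter_upwards [T.ae_gradient_add ΓD v v₂ (D.subset m)] with x hx
        rw [hx, inner_add_right]
      have h2 : ∫ x in D.dom m, u.1 x * (v + v₂).1 x =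
          (∫ x in D.dom m, u.1 x * v.1 x) + ∫ x in D.dom m, u.1 x * v₂.1 x := by
        rw [← integral_add (T.integrableOn_mul ΓD u v (D.subset m))
          (T.integrableOn_mul ΓD u v₂ (D.subset m))]
        exact integral_congr_ae (.of_forall fun x => mul_add (u.1 x) (v.1 x) (v₂.1 x))
      rw [h1, h2]
      ring)
    (fun c u v => by
      rw [smul_eq_mul, Finset.mul_sum]
      refine Finset.sum_congr rfl fun m _ => ?_
      have h1 : ∫ x in D.dom m, inner ℝ (∇ u.1 x) (∇ (c • v).1 x) =
          c * ∫ x in D.dom m, inner ℝ (∇ u.1 x) (∇ v.1 x) := by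
        rw [← integral_const_mul]
        refine integral_congr_ae (.of_forall fun x => ?_)
        simp only [T.gradient_smul ΓD c v x, real_inner_smul_right]
      have h2 : ∫ x in D.dom m, u.1 x * (c • v).1 x = c * ∫ x in D.dom m, u.1 x * v.1 x := by
        rw [← integral_const_mul]
        exact integral_congr_ae (.of_forall fun x => mul_left_comm (u.1 x) c (v.1 x))
      rw [h1, h2]
      ring)

/-- The operator `A : V → V` with `(A w, v) = a(w, v)`, see `massForm_stiffness`. -/
def stiffness : Module.End ℝ (T.feSpace ΓD) :=
  ((T.massForm ΓD).toDual (T.massForm_nondegenerate ΓD)).symm.toLinearMap ∘ₗ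
    T.energyForm ΓD D ω ρ

lemma massForm_stiffness (w v : T.feSpace ΓD) :
    T.massForm ΓD (T.stiffness ΓD D ω ρ w) v = T.energyForm ΓD D ω ρ w v :=
  LinearMap.BilinForm.apply_toDual_symm_apply (hB := T.massForm_nondegenerate ΓD) _ _

/-- Symmetric positive definite operators, with respect to the `L²` inner product. -/
def IsSPD (R : Module.End ℝ (T.feSpace ΓD)) : Prop :=
  (∀ u v, T.massForm ΓD (R u) v = T.massForm ΓD u (R v)) ∧
    ∀ u, u ≠ 0 → 0 < T.massForm ΓD (R u) u

end Triangulation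

/-- Triangulations of levels `0, …, L`, each one refining the previous ones. -/
structure MeshHierarchy (Ω : PolyDomain d) (L : ℕ) where
  mesh : Fin (L + 1) → Triangulation Ω
  nested : ∀ j k, j ≤ k → (mesh k).Refines (mesh j)

namespace MeshHierarchy

variable {L : ℕ} (𝒯 : MeshHierarchy Ω L) (ΓD : Set (Pt d))

/-- The mesh size of level `k`. -/
def h (k : Fin (L + 1)) : ℝ := (𝒯.mesh k).meshSize

/-- The finite element space of level `k`. -/
abbrev V (k : Fin (L + 1)) : Submodule ℝ (Pt d → ℝ) := (𝒯.mesh k).feSpace ΓD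

/-- The finest finite element space. -/
abbrev Vh : Submodule ℝ (Pt d → ℝ) := 𝒯.V ΓD (Fin.last L)

/-- Uniform refinement: all meshes are quasi-uniform with the same constant, the mesh sizes
decrease geometrically, `h k ≃ γ ^ k * h 0`, and the coarsest mesh size is at most of unit
order. -/
structure IsUniform (γ κ : ℝ) : Prop where
  quasiUniform : ∀ k, (𝒯.mesh k).QuasiUniform κ
  size_lower : ∀ k : Fin (L + 1), κ⁻¹ * (γ ^ (k : ℕ) * 𝒯.h 0) ≤ 𝒯.h k
  size_upper : ∀ k : Fin (L + 1), 𝒯.h k ≤ κ * (γ ^ (k : ℕ) * 𝒯.h 0)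
  size_coarse : 𝒯.h 0 ≤ κ

/-- The inclusion of level `k` into the finest space. -/
def incl (k : Fin (L + 1)) : 𝒯.V ΓD k →ₗ[ℝ] 𝒯.Vh ΓD :=
  Submodule.inclusion (Triangulation.feSpace_mono (𝒯.nested k (Fin.last L) (Fin.le_last k)) ΓD)

/-- The `L²` projection of the finest space onto level `k`, see `massForm_proj`. -/
def proj (k : Fin (L + 1)) : 𝒯.Vh ΓD →ₗ[ℝ] 𝒯.V ΓD k :=
  (((𝒯.mesh k).massForm ΓD).toDual
      ((𝒯.mesh k).massForm_nondegenerate ΓD)).symm.toLinearMap ∘ₗ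
    (𝒯.incl ΓD k).dualMap ∘ₗ (𝒯.mesh (Fin.last L)).massForm ΓD

lemma massForm_proj (k : Fin (L + 1)) (u : 𝒯.Vh ΓD) (v : 𝒯.V ΓD k) :
    (𝒯.mesh k).massForm ΓD (𝒯.proj ΓD k u) v =
      (𝒯.mesh (Fin.last L)).massForm ΓD u (𝒯.incl ΓD k v) :=
  LinearMap.BilinForm.apply_toDual_symm_apply
    (hB := (𝒯.mesh k).massForm_nondegenerate ΓD) _ _

variable {M : ℕ} (D : Subdomains Ω M) (ω ρ : Fin M → ℝ)

/-- The operator `A k` of level `k`. -/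
abbrev A (k : Fin (L + 1)) : Module.End ℝ (𝒯.V ΓD k) := (𝒯.mesh k).stiffness ΓD D ω ρ

/-- Admissible smoothers on the levels `k = 1, …, L`: symmetric positive definite, with
`(R k⁻¹ u, u) ≃ h k⁻² ‖u‖²` in the norm with weight `ω + h k² ρ`. -/
def IsSmoother (c : ℝ) (R : ∀ k : Fin (L + 1), Module.End ℝ (𝒯.V ΓD k)) : Prop :=
  ∀ k, k ≠ 0 → (𝒯.mesh k).IsSPD ΓD (R k) ∧ ∀ u : 𝒯.V ΓD k,
    c⁻¹ * ((𝒯.h k ^ 2)⁻¹ * weightedL2Sq D (fun m => ω m + 𝒯.h k ^ 2 * ρ m) u.1) ≤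
        (𝒯.mesh k).massForm ΓD (Ring.inverse (R k) u) u ∧
      (𝒯.mesh k).massForm ΓD (Ring.inverse (R k) u) u ≤
        c * ((𝒯.h k ^ 2)⁻¹ * weightedL2Sq D (fun m => ω m + 𝒯.h k ^ 2 * ρ m) u.1)

/-- The BPX preconditioner `B = ∑ₖ Rₖ Qₖ`, with the exact solver `A 0⁻¹` in place of `R 0` on the
coarsest level. -/
def bpx (R : ∀ k : Fin (L + 1), Module.End ℝ (𝒯.V ΓD k)) : Module.End ℝ (𝒯.Vh ΓD) :=
  ∑ k, 𝒯.incl ΓD k ∘ₗ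
    (if k = 0 then Ring.inverse (𝒯.A ΓD D ω ρ k) else R k) ∘ₗ 𝒯.proj ΓD k

end MeshHierarchy

end BPX

end

noncomputable section

namespace BPX

/-! ### Inverse inequality for one affine function -/

variable {d : ℕ} {Ω : PolyDomain d}

/-! Write `B = ∑ I_k S_k Q_k`, where `I_k` is the inclusion of level `k`, `S_0 = A_0⁻¹` and `S_k =
R_k` otherwise. Since `I_k` is the `L²` adjoint of `Q_k`, `(Bw, w) = ∑ (S_k Q_k w, Q_k w)`. Every
term is nonnegative and the finest one is definite because `Q_L` is the identity, so `B` is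
symmetric positive definite and every `u` equals some `Bw`.

This gives the decomposition `u = ∑ x_k` with `x_k = S_k Q_k w`. Cauchy–Schwarz over the levels
costs a factor `L + 1`: `a(u, u) ≤ (L + 1) ∑ a(x_k, x_k)` (`bilinForm_sum_self_le`). On each level
`a(x_k, x_k) ≤ K (S_k Q_k w, Q_k w)`: for `k = 0` the solver is exact, and for `k ≥ 1` the inverse
inequality (`energyForm_self_le`) meets the lower bound on `R_k⁻¹`. Summing yields `K (L + 1) (Bw,
w) = K (L + 1) (B⁻¹u, u)`, and geometric refinement makes `L + 1` at most a multiple of `|log h|`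
(`levels_le_log`).

No constant depends on `ω` or `ρ`: the inverse inequality is proved cell by cell, and the interior
of a cell lies in a single subdomain or misses it, so the coefficients factor out. No orthogonality
between levels is used, hence the logarithm.

The eigenvalue bound follows because `BA` is self-adjoint for the energy form and `BAu = λu` means
`Au = λB⁻¹u`. -/

lemma exists_hasGradientAt_affineMap (g : Pt d →ᵃ[ℝ] ℝ) :
    ∃ G : Pt d, (∀ x y, g y = g x + inner ℝ G (y - x)) ∧ ∀ x, HasGradientAt g G x := by
  refine ⟨(InnerProductSpace.toDual ℝ (Pt d)).symm (LinearMap.toContinuousLinearMap g.linear),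
    fun x y => ?_, fun x => ?_⟩
  · rw [InnerProductSpace.toDual_symm_apply]
    have := g.linearMap_vsub y x
    simp only [vsub_eq_sub] at this
    simp [this]
  · rw [hasGradientAt_iff_hasFDerivAt, LinearIsometryEquiv.apply_symm_apply]
    have h1 : HasFDerivAt (fun z => LinearMap.toContinuousLinearMap g.linear z + g 0)
        (LinearMap.toContinuousLinearMap g.linear) x :=
      (ContinuousLinearMap.hasFDerivAt _).add_const _
    refine h1.congr_of_eventuallyEq (.of_forall fun z => ?_)
    simpa using congrFun g.decomp z

/-- The local inverse inequality for affine functions on a set of controlled shape. -/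
lemma norm_sq_mul_volume_le {κ h : ℝ} (hκ : 0 < κ) (hh : 0 < h) {S : Set (Pt d)} {g : Pt d → ℝ}
    {G x : Pt d} (hg : ∀ y, g y = g x + inner ℝ G (y - x)) (hball : Metric.ball x (h / κ) ⊆ S)
    (hS : S ⊆ Metric.closedBall x h) (hint : IntegrableOn (fun y => g y ^ 2) S) :
    ‖G‖ ^ 2 * volume.real S ≤
      16 * κ ^ 2 * (4 * κ) ^ d * ((h ^ 2)⁻¹ * ∫ y in S, g y ^ 2) := by
  set r := h / κ with hr
  have hr0 : 0 < r := div_pos hh hκ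
  have hI : 0 ≤ ∫ y in S, g y ^ 2 := integral_nonneg fun y => sq_nonneg _
  by_cases hG : G = 0
  · simp only [hG, norm_zero]
    have : (0 : ℝ) ≤ 16 * κ ^ 2 * (4 * κ) ^ d * ((h ^ 2)⁻¹ * ∫ y in S, g y ^ 2) := by positivity
    simpa using this
  have hG0 : 0 < ‖G‖ := norm_pos_iff.2 hG
  -- `σ` is a sign of `g x`; moving from `x` along `σ G` makes `|g|` grow.
  obtain ⟨σ, hσ2, hσ⟩ : ∃ σ : ℝ, σ ^ 2 = 1 ∧ 0 ≤ σ * g x := by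
    rcases le_total 0 (g x) with h0 | h0
    · exact ⟨1, by norm_num, by simpa using h0⟩
    · exact ⟨-1, by norm_num, by simpa using h0⟩
  have hσa : |σ| = 1 := by
    rw [← sq_eq_sq₀ (abs_nonneg σ) zero_le_one, sq_abs, hσ2, one_pow]
  set w : Pt d := (r / 2 * σ / ‖G‖) • G with hw
  have hwn : ‖w‖ = r / 2 := by
    rw [hw, norm_smul, Real.norm_eq_abs, abs_div, abs_mul, hσa, abs_of_pos (half_pos hr0),
      abs_of_pos hG0]
    field_simp
  have hwG : σ * inner ℝ G w = r / 2 * ‖G‖ := by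
    rw [hw, real_inner_smul_right, real_inner_self_eq_norm_sq]
    field_simp
    rw [hσ2]
  -- The centre moves by `r / 2`, so the ball of radius `r / 4` stays within distance `3r / 4 < r`
  -- of `x`, while `σ g ≥ ‖G‖ (r / 2 - r / 4)` on it.
  have hsub : Metric.closedBall (x + w) (r / 4) ⊆ S := by
    refine Subset.trans (fun y hy => ?_) hball
    rw [Metric.mem_ball, dist_eq_norm]
    rw [Metric.mem_closedBall, dist_eq_norm] at hy
    have : y - x = (y - (x + w)) + w := by abel
    rw [this]
    calc _ ≤ ‖y - (x + w)‖ + ‖w‖ := norm_add_le _ _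
      _ < r := by rw [hwn]; linarith
  have hlow : ∀ y ∈ Metric.closedBall (x + w) (r / 4), (‖G‖ * r / 4) ^ 2 ≤ g y ^ 2 := by
    intro y hy
    rw [Metric.mem_closedBall, dist_eq_norm] at hy
    have e : y - x = w + (y - (x + w)) := by abel
    have h1 : σ * g y = σ * g x + r / 2 * ‖G‖ + σ * inner ℝ G (y - (x + w)) := by
      rw [hg y, e, inner_add_right, ← hwG]
      ring
    have h2 : |σ * inner ℝ G (y - (x + w))| ≤ ‖G‖ * (r / 4) := by
      rw [abs_mul, hσa, one_mul]
      exact (abs_real_inner_le_norm _ _).trans (mul_le_mul_of_nonneg_left hy hG0.le)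
    have h3 : ‖G‖ * r / 4 ≤ σ * g y := by
      have := neg_le_of_abs_le h2
      rw [h1]
      linarith
    calc (‖G‖ * r / 4) ^ 2 ≤ (σ * g y) ^ 2 := pow_le_pow_left₀ (by positivity) h3 2
      _ = g y ^ 2 := by rw [mul_pow, hσ2, one_mul]
  have hfin : volume (Metric.closedBall (x + w) (r / 4)) ≠ ⊤ := measure_closedBall_lt_top.ne
  have hge : (‖G‖ * r / 4) ^ 2 * volume.real (Metric.closedBall (x + w) (r / 4)) ≤
      ∫ y in S, g y ^ 2 :=
    (setIntegral_ge_of_const_le_real measurableSet_closedBall hfin hlow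
      (hint.mono_set hsub)).trans
      (setIntegral_mono_set hint (.of_forall fun y => sq_nonneg _) (.of_forall hsub))
  -- The ratio of the radii `h` and `r / 4 = h / (4κ)` is `4κ`. The other factor `16 κ²` of the
  -- constant comes from `(r / 4)² = h² / (16 κ²)`.
  have hvol : volume.real S ≤
      (4 * κ) ^ d * volume.real (Metric.closedBall (x + w) (r / 4)) := by
    refine (measureReal_mono hS measure_closedBall_lt_top.ne).trans (le_of_eq ?_)
    rw [Measure.addHaar_real_closedBall _ _ hh.le,
      Measure.addHaar_real_closedBall _ _ (by positivity : 0 ≤ r / 4), finrank_euclideanSpace_fin,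
      ← mul_assoc, ← mul_pow]
    congr 2
    rw [hr]
    field_simp
  calc ‖G‖ ^ 2 * volume.real S
      ≤ ‖G‖ ^ 2 * ((4 * κ) ^ d * volume.real (Metric.closedBall (x + w) (r / 4))) := by gcongr
    _ = 16 * κ ^ 2 * (4 * κ) ^ d * ((h ^ 2)⁻¹ *
        ((‖G‖ * r / 4) ^ 2 * volume.real (Metric.closedBall (x + w) (r / 4)))) := by
      rw [hr]
      field_simp
      ring
    _ ≤ _ := by gcongr

/-! ### Geometry of the cells and splitting of integrals -/

namespace Triangulation

variable (T : Triangulation Ω)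

lemma nonempty_interior_cell {s : Finset (Pt d)} (hs : s ∈ T.cells) :
    (interior (convexHull ℝ (s : Set (Pt d)))).Nonempty := by
  rw [interior_convexHull_nonempty_iff_affineSpan_eq_top]
  have h := (T.indep s hs).affineSpan_eq_top_iff_card_eq_finrank_add_one
  rw [Subtype.range_coe_subtype, Finset.setOfPred_mem] at h
  exact h.2 (by simp [T.card_cell s hs])

lemma cell_subset_closure_interior {s : Finset (Pt d)} (hs : s ∈ T.cells) :
    convexHull ℝ (s : Set (Pt d)) ⊆ closure (interior (convexHull ℝ (s : Set (Pt d)))) := by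
  rw [(convex_convexHull ℝ _).closure_interior_eq_closure_of_nonempty_interior
    (T.nonempty_interior_cell hs)]
  exact subset_closure

/-- By conformity the intersection is the simplex on the common vertices. There are at most `d` of
these, too few to span the space, so this simplex has empty interior. -/
lemma disjoint_interior_cells {s t : Finset (Pt d)} (hs : s ∈ T.cells) (ht : t ∈ T.cells)
    (hst : s ≠ t) : Disjoint (interior (convexHull ℝ (s : Set (Pt d))))
      (interior (convexHull ℝ (t : Set (Pt d)))) := by
  classical
  rw [disjoint_iff_inter_eq_empty, ← interior_inter, T.conforming s hs t ht, ← Finset.coe_inter,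
    ← not_nonempty_iff_eq_empty, interior_convexHull_nonempty_iff_affineSpan_eq_top]
  intro htop
  have hlt : (s ∩ t).card < d + 1 := by
    rw [← T.card_cell s hs]
    refine Finset.card_lt_card ⟨Finset.inter_subset_left, fun h => hst ?_⟩
    refine Finset.eq_of_subset_of_card_le (fun x hx => (Finset.mem_inter.1 (h hx)).2) ?_
    rw [T.card_cell s hs, T.card_cell t ht]
  have hind : AffineIndependent ℝ ((↑) : (s ∩ t : Finset (Pt d)) → Pt d) :=
    (T.indep s hs).mono (Finset.coe_subset.2 Finset.inter_subset_left)
  have h := hind.affineSpan_eq_top_iff_card_eq_finrank_add_one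
  rw [Subtype.range_coe_subtype, Finset.setOfPred_mem] at h
  have := h.1 htop
  simp only [Fintype.card_coe, finrank_euclideanSpace_fin] at this
  omega

/-- The cells of a refinement lie inside a resolved subdomain or outside of it. -/
lemma interior_cell_subset_or_disjoint {T₀ : Triangulation Ω} {M : ℕ} {D : Subdomains Ω M}
    (h₀ : T₀.Resolves D) (h : T.Refines T₀) (m : Fin M) {s : Finset (Pt d)} (hs : s ∈ T.cells) :
    interior (convexHull ℝ (s : Set (Pt d))) ⊆ D.dom m ∨
      Disjoint (D.dom m) (interior (convexHull ℝ (s : Set (Pt d)))) := by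
  obtain ⟨t, ht, hst⟩ := h s hs
  obtain ⟨S, hS, hcl⟩ := h₀ m
  by_cases htS : t ∈ S
  · left
    rw [← D.regular m, hcl]
    exact interior_mono (hst.trans (subset_biUnion_of_mem (u := fun t : Finset (Pt d) =>
      convexHull ℝ (t : Set (Pt d))) htS))
  · right
    rw [Set.disjoint_left]
    intro x hxm hxs
    have hx : x ∈ closure (D.dom m) := subset_closure hxm
    rw [hcl] at hx
    simp only [mem_iUnion] at hx
    obtain ⟨t', ht', hxt'⟩ := hx
    -- `x` lies in another coarse cell `t'`, perhaps on its boundary. As `t'` is in the closure of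
    -- its interior, a nearby point is interior to both `t` and `t'`, which is impossible.
    obtain ⟨y, hy, hy'⟩ := mem_closure_iff.1 (T₀.cell_subset_closure_interior (hS ht') hxt') _
      isOpen_interior (interior_mono hst hxs)
    exact Set.disjoint_left.1 (T₀.disjoint_interior_cells ht (hS ht')
      (fun e => htS (e ▸ ht'))) hy hy'

/-- Frontiers of convex sets are null, so the disjoint interiors of the cells exhaust `U` up to a
null set. -/
lemma setIntegral_eq_sum_cells {U : Set (Pt d)} (hU : IsOpen U) (hUΩ : U ⊆ closure Ω.carrier)
    {f : Pt d → ℝ} (hf : IntegrableOn f U) :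
    ∫ x in U, f x = ∑ s ∈ T.cells, ∫ x in U ∩ interior (convexHull ℝ (s : Set (Pt d))), f x := by
  rw [← integral_biUnion_finset T.cells
    (s := fun s => U ∩ interior (convexHull ℝ (s : Set (Pt d))))
    (fun s _ => (hU.inter isOpen_interior).measurableSet)
    (fun s hs t ht hst => (T.disjoint_interior_cells hs ht hst).mono inter_subset_right
      inter_subset_right) (fun s _ => hf.mono_set inter_subset_left)]
  refine setIntegral_congr_set ?_
  have hfr : ∀ᵐ x : Pt d, ∀ s ∈ T.cells, x ∉ frontier (convexHull ℝ (s : Set (Pt d))) := by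
    rw [Finset.eventually_all]
    intro s _
    exact measure_eq_zero_iff_ae_notMem.1 ((convex_convexHull ℝ _).addHaar_frontier _)
  filter_upwards [hfr] with x hx
  refine propext ⟨fun hxU => ?_, fun hx' => ?_⟩
  · have hxΩ := hUΩ hxU
    rw [← T.cover] at hxΩ
    simp only [mem_iUnion] at hxΩ
    obtain ⟨s, hs, hxs⟩ := hxΩ
    refine mem_biUnion hs ⟨hxU, ?_⟩
    by_contra hcon
    exact hx s hs ⟨subset_closure hxs, hcon⟩
  · obtain ⟨s, hs, hxs⟩ := mem_iUnion₂.1 hx'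
    exact hxs.1

lemma diam_cell_le {s : Finset (Pt d)} (hs : s ∈ T.cells) :
    Metric.diam (convexHull ℝ (s : Set (Pt d))) ≤ T.meshSize :=
  le_ciSup (f := fun s : T.cells => Metric.diam (convexHull ℝ ((s : Finset (Pt d)) : Set (Pt d))))
    (Set.finite_range _).bddAbove ⟨s, hs⟩

lemma cells_nonempty : T.cells.Nonempty := by
  obtain ⟨x, hx⟩ := Ω.isConnected.nonempty
  have := subset_closure hx
  rw [← T.cover] at this
  simp only [mem_iUnion] at this
  obtain ⟨s, hs, _⟩ := this
  exact ⟨s, hs⟩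

lemma isBounded_cell (s : Finset (Pt d)) : Bornology.IsBounded (convexHull ℝ (s : Set (Pt d))) :=
  (s.finite_toSet.isCompact_convexHull ℝ).isBounded

lemma meshSize_pos (hd : 0 < d) : 0 < T.meshSize := by
  obtain ⟨s, hs⟩ := T.cells_nonempty
  obtain ⟨x, hx, y, hy, hxy⟩ := Finset.one_lt_card.1 (by rw [T.card_cell s hs]; omega : 1 < s.card)
  calc 0 < dist x y := dist_pos.2 hxy
    _ ≤ Metric.diam (convexHull ℝ (s : Set (Pt d))) :=
      Metric.dist_le_diam_of_mem (isBounded_cell s) (subset_convexHull ℝ _ hx)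
        (subset_convexHull ℝ _ hy)
    _ ≤ _ := T.diam_cell_le hs

/-! ### Inverse inequality for finite element functions -/

variable (ΓD : Set (Pt d))

lemma exists_affine_on_cell (u : T.feSpace ΓD) {s : Finset (Pt d)} (hs : s ∈ T.cells) :
    ∃ (g : Pt d → ℝ) (G : Pt d), (∀ x y, g y = g x + inner ℝ G (y - x)) ∧
      EqOn u.1 g (convexHull ℝ (s : Set (Pt d))) ∧
      ∀ x ∈ interior (convexHull ℝ (s : Set (Pt d))), ∇ u.1 x = G := by
  obtain ⟨g, hg⟩ := u.2.2.1 s hs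
  obtain ⟨G, hG, hGd⟩ := exists_hasGradientAt_affineMap g
  refine ⟨g, G, hG, hg, fun x hx => ?_⟩
  have hev : u.1 =ᶠ[nhds x] g :=
    Filter.eventuallyEq_of_mem (mem_interior_iff_mem_nhds.1 hx) hg
  rw [← (hGd x).gradient]
  unfold gradient
  rw [hev.fderiv_eq]

/-- The inverse inequality on a resolved subdomain. -/
lemma integral_gradient_sq_le (hd : 0 < d) {κ : ℝ} (hκ : 0 < κ) (hT : T.QuasiUniform κ)
    {T₀ : Triangulation Ω} {M : ℕ} {D : Subdomains Ω M}
    (h₀ : T₀.Resolves D) (h : T.Refines T₀) (m : Fin M) (u : T.feSpace ΓD) :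
    ∫ x in D.dom m, inner ℝ (∇ u.1 x) (∇ u.1 x) ≤
      16 * κ ^ 2 * (4 * κ) ^ d * ((T.meshSize ^ 2)⁻¹ * ∫ x in D.dom m, u.1 x ^ 2) := by
  have hi2 : IntegrableOn (fun x => u.1 x ^ 2) (D.dom m) := by
    simpa only [sq] using T.integrableOn_mul ΓD u u (D.subset m)
  rw [T.setIntegral_eq_sum_cells (D.isOpen m) (D.subset m)
    (T.integrableOn_gradient ΓD u u (D.subset m)),
    T.setIntegral_eq_sum_cells (D.isOpen m) (D.subset m) hi2, Finset.mul_sum, Finset.mul_sum]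
  refine Finset.sum_le_sum fun s hs => ?_
  rcases T.interior_cell_subset_or_disjoint h₀ h m hs with hsub | hdis
  · rw [inter_eq_self_of_subset_right hsub]
    obtain ⟨g, G, hg, hug, hgrad⟩ := T.exists_affine_on_cell ΓD u hs
    set S := interior (convexHull ℝ (s : Set (Pt d))) with hS
    have hSm : MeasurableSet S := isOpen_interior.measurableSet
    have hug' : EqOn (fun x => u.1 x ^ 2) (fun x => g x ^ 2) S := fun x hx => by
      simp only [hug (interior_subset hx)]
    rw [setIntegral_congr_fun hSm (fun x hx => by simp only [hgrad x hx] :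
      EqOn (fun x => inner ℝ (∇ u.1 x) (∇ u.1 x)) (fun _ => inner ℝ G G) S),
      setIntegral_congr_fun hSm hug', setIntegral_const, smul_eq_mul, mul_comm,
      real_inner_self_eq_norm_sq]
    obtain ⟨x, hx⟩ := hT s hs
    have hpos := T.meshSize_pos hd
    refine norm_sq_mul_volume_le hκ hpos (hg x) ?_ ?_ ?_ (x := x)
    · exact interior_maximal (Metric.ball_subset_closedBall.trans hx) Metric.isOpen_ball
    · intro y hy
      have hxs : x ∈ convexHull ℝ (s : Set (Pt d)) :=
        hx (Metric.mem_closedBall_self (div_pos hpos hκ).le)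
      exact (Metric.dist_le_diam_of_mem (isBounded_cell s) (interior_subset hy) hxs).trans
        (T.diam_cell_le hs)
    · exact (hi2.mono_set hsub).congr_fun hug' hSm
  · simp [disjoint_iff_inter_eq_empty.1 hdis]

variable {M : ℕ} (D : Subdomains Ω M) (ω ρ : Fin M → ℝ)

lemma energyForm_apply (u v : T.feSpace ΓD) : T.energyForm ΓD D ω ρ u v =
    ∑ m, (ω m * (∫ x in D.dom m, inner ℝ (∇ u.1 x) (∇ v.1 x)) +
      ρ m * ∫ x in D.dom m, u.1 x * v.1 x) := rfl

lemma massForm_apply (u v : T.feSpace ΓD) :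
    T.massForm ΓD u v = ∫ x in Ω.carrier, u.1 x * v.1 x := rfl

lemma massForm_comm (u v : T.feSpace ΓD) : T.massForm ΓD u v = T.massForm ΓD v u := by
  simp only [massForm_apply, mul_comm]

lemma energyForm_comm (u v : T.feSpace ΓD) :
    T.energyForm ΓD D ω ρ u v = T.energyForm ΓD D ω ρ v u := by
  simp only [energyForm_apply, mul_comm (u.1 _), real_inner_comm (∇ u.1 _)]

variable {ω ρ}

/-- The inverse inequality in the weighted norm. -/
lemma energyForm_self_le (hd : 0 < d) {κ : ℝ} (hκ : 1 ≤ κ) (hT : T.QuasiUniform κ)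
    {T₀ : Triangulation Ω} (h₀ : T₀.Resolves D) (h : T.Refines T₀)
    (hω : ∀ m, 0 < ω m) (hρ : ∀ m, 0 ≤ ρ m) (u : T.feSpace ΓD) :
    T.energyForm ΓD D ω ρ u u ≤ 16 * κ ^ 2 * (4 * κ) ^ d * ((T.meshSize ^ 2)⁻¹ *
      weightedL2Sq D (fun m => ω m + T.meshSize ^ 2 * ρ m) u.1) := by
  have hpos := T.meshSize_pos hd
  -- Needed for the reaction term: there `h²` in the weight cancels `h⁻²`, and any constant at least
  -- `1` will do.
  have hC : 1 ≤ 16 * κ ^ 2 * (4 * κ) ^ d := by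
    have h1 : 1 ≤ κ ^ 2 := one_le_pow₀ hκ
    have h2 : 1 ≤ (4 * κ) ^ d := one_le_pow₀ (by linarith)
    nlinarith
  rw [energyForm_apply, weightedL2Sq, Finset.mul_sum, Finset.mul_sum]
  refine Finset.sum_le_sum fun m _ => ?_
  have hI : 0 ≤ ∫ x in D.dom m, u.1 x ^ 2 := integral_nonneg fun y => sq_nonneg _
  have hgr := T.integral_gradient_sq_le ΓD hd (by linarith) hT h₀ h m u
  simp only [← sq]
  calc _ ≤ ω m * (16 * κ ^ 2 * (4 * κ) ^ d *
          ((T.meshSize ^ 2)⁻¹ * ∫ x in D.dom m, u.1 x ^ 2)) +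
        ρ m * (16 * κ ^ 2 * (4 * κ) ^ d * ∫ x in D.dom m, u.1 x ^ 2) := by
        refine add_le_add (mul_le_mul_of_nonneg_left hgr (hω m).le)
          (mul_le_mul_of_nonneg_left ?_ (hρ m))
        exact le_mul_of_one_le_left hI hC
    _ = _ := by
      field_simp

/-! ### Positive definiteness of the energy -/

lemma energyForm_self_nonneg (hω : ∀ m, 0 < ω m) (hρ : ∀ m, 0 ≤ ρ m) (u : T.feSpace ΓD) :
    0 ≤ T.energyForm ΓD D ω ρ u u := by
  rw [energyForm_apply]
  refine Finset.sum_nonneg fun m _ => add_nonneg ?_ ?_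
  · exact mul_nonneg (hω m).le (integral_nonneg fun _ => real_inner_self_nonneg)
  · exact mul_nonneg (hρ m) (integral_nonneg fun x => mul_self_nonneg _)

lemma gradient_ae_zero_of_energyForm_eq_zero (hω : ∀ m, 0 < ω m) (hρ : ∀ m, 0 ≤ ρ m)
    (u : T.feSpace ΓD) (hu : T.energyForm ΓD D ω ρ u u = 0) (m : Fin M) :
    (∀ᵐ x ∂(volume.restrict (D.dom m)), ∇ u.1 x = 0) ∧
      ρ m * ∫ x in D.dom m, u.1 x * u.1 x = 0 := by
  have h1 : ∀ m, 0 ≤ ω m * ∫ x in D.dom m, inner ℝ (∇ u.1 x) (∇ u.1 x) := fun m =>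
    mul_nonneg (hω m).le (integral_nonneg fun _ => real_inner_self_nonneg)
  have h2 : ∀ m, 0 ≤ ρ m * ∫ x in D.dom m, u.1 x * u.1 x := fun m =>
    mul_nonneg (hρ m) (integral_nonneg fun x => mul_self_nonneg _)
  rw [energyForm_apply, Finset.sum_eq_zero_iff_of_nonneg fun m _ => add_nonneg (h1 m) (h2 m)] at hu
  have hm := hu m (Finset.mem_univ m)
  rw [add_eq_zero_iff_of_nonneg (h1 m) (h2 m)] at hm
  refine ⟨?_, hm.2⟩
  have h3 := (mul_eq_zero.1 hm.1).resolve_left (hω m).ne'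
  rw [integral_eq_zero_iff_of_nonneg (fun x => real_inner_self_nonneg)
    (T.integrableOn_gradient ΓD u u (D.subset m))] at h3
  filter_upwards [h3] with x hx
  exact inner_self_eq_zero.1 hx

/-- The interior of each cell meets some subdomain in a nonempty open set, which has positive
measure; hence the constant gradient on that cell is zero. So `u` takes finitely many values on a
connected set and, being continuous, is constant. No chains of neighbouring cells are needed. -/
lemma eqOn_const_of_gradient_ae_zero (u : T.feSpace ΓD)
    (hu : ∀ m, ∀ᵐ x ∂(volume.restrict (D.dom m)), ∇ u.1 x = 0) :
    ∃ b : ℝ, ∀ x ∈ closure Ω.carrier, u.1 x = b := by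
  have hcell : ∀ s ∈ T.cells, ∃ b : ℝ, ∀ x ∈ convexHull ℝ (s : Set (Pt d)), u.1 x = b := by
    intro s hs
    obtain ⟨g, G, hg, hug, hgrad⟩ := T.exists_affine_on_cell ΓD u hs
    obtain ⟨x, hx⟩ := T.nonempty_interior_cell hs
    have hxΩ : x ∈ closure Ω.carrier := by
      rw [← T.cover]
      exact mem_biUnion hs (interior_subset hx)
    rw [← D.cover] at hxΩ
    obtain ⟨m, hm⟩ := mem_iUnion.1 hxΩ
    have hne := mem_closure_iff.1 hm _ isOpen_interior hx
    have hopen : IsOpen (interior (convexHull ℝ (s : Set (Pt d))) ∩ D.dom m) :=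
      isOpen_interior.inter (D.isOpen m)
    have hG : G = 0 := by
      have h1 := ae_restrict_of_ae_restrict_of_subset
        (inter_subset_right (s := interior (convexHull ℝ (s : Set (Pt d))))) (hu m)
      rw [ae_restrict_iff' hopen.measurableSet] at h1
      by_contra hcon
      refine (hopen.measure_pos volume hne).ne' (measure_mono_null (fun y hy => ?_) h1)
      exact fun h => hcon ((hgrad y hy.1).symm.trans (h hy))
    refine ⟨g x, fun y hy => ?_⟩
    rw [hug hy, hg x y, hG, inner_zero_left, add_zero]
  choose! b hb using hcell
  have hfin : (u.1 '' closure Ω.carrier).Finite := by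
    refine (T.cells.finite_toSet.image b).subset ?_
    rintro _ ⟨x, hx, rfl⟩
    rw [← T.cover] at hx
    obtain ⟨s, hs, hxs⟩ := mem_iUnion₂.1 hx
    exact ⟨s, hs, (hb s hs x hxs).symm⟩
  have hsub : (u.1 '' closure Ω.carrier).Subsingleton :=
    (show (u.1 '' closure Ω.carrier).Countable from hfin.countable).isTotallyDisconnected _ le_rfl
      (Ω.isConnected.closure.isPreconnected.image _ u.2.1)
  obtain ⟨x, hx⟩ := Ω.isConnected.closure.nonempty
  exact ⟨u.1 x, fun y hy => hsub (mem_image_of_mem _ hy) (mem_image_of_mem _ hx)⟩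

/-- Zero energy forces `u` to be constant. The constant vanishes either because some `ρ m > 0`
charges a subdomain of positive volume, or because the trace vanishes almost everywhere on a
boundary part of nonzero surface measure. -/
lemma energyForm_self_pos (hΓ : ΓD ⊆ frontier Ω.carrier) (hω : ∀ m, 0 < ω m) (hρ : ∀ m, 0 ≤ ρ m)
    (hcoer : (∃ m, 0 < ρ m) ∨ Measure.hausdorffMeasure ((d : ℝ) - 1) ΓD ≠ 0)
    {u : T.feSpace ΓD} (hu : u ≠ 0) : 0 < T.energyForm ΓD D ω ρ u u := by
  refine lt_of_le_of_ne (T.energyForm_self_nonneg ΓD D hω hρ u) fun h => hu ?_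
  have hz := T.gradient_ae_zero_of_energyForm_eq_zero ΓD D hω hρ u h.symm
  obtain ⟨b, hb⟩ := T.eqOn_const_of_gradient_ae_zero ΓD D u fun m => (hz m).1
  have hb0 : b = 0 := by
    rcases hcoer with ⟨m, hm⟩ | hH
    · have h1 := (mul_eq_zero.1 (hz m).2).resolve_left hm.ne'
      rw [setIntegral_congr_fun (D.isOpen m).measurableSet
        (fun x hx => by simp only [hb x (D.subset m hx)] :
          EqOn (fun x => u.1 x * u.1 x) (fun _ => b * b) (D.dom m)), setIntegral_const,
        smul_eq_mul] at h1
      refine mul_self_eq_zero.1 ((mul_eq_zero.1 h1).resolve_left ?_)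
      refine (ENNReal.toReal_pos ((D.isOpen m).measure_pos volume (D.nonempty m)).ne' ?_).ne'
      exact ((measure_mono (D.subset m)).trans_lt T.isCompact_closure.measure_lt_top).ne
    · by_contra hcon
      refine hH ?_
      rw [← Measure.restrict_apply_self]
      refine measure_mono_null (fun x hx => ?_) u.2.2.2.1
      change ¬ u.1 x = 0
      rwa [hb x (frontier_subset_closure (hΓ hx))]
  ext x
  change u.1 x = 0
  by_cases hx : x ∈ closure Ω.carrier
  · rw [hb x hx, hb0]
  · exact u.2.2.2.2 x hx

end Triangulation

/-! ### Linear algebra of forms and operators -/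

section LinearAlgebra

variable {V : Type*} [AddCommGroup V] [Module ℝ V]

/-- Expand `∑ i, ∑ j, a (x i - x j) (x i - x j) ≥ 0`; this is Cauchy–Schwarz with all weights one.
-/
lemma bilinForm_sum_self_le {ι : Type*} [Fintype ι] (a : LinearMap.BilinForm ℝ V)
    (hsymm : ∀ u v, a u v = a v u) (hpos : ∀ u, 0 ≤ a u u) (x : ι → V) :
    a (∑ i, x i) (∑ i, x i) ≤ Fintype.card ι * ∑ i, a (x i) (x i) := by
  have h : 0 ≤ ∑ i, ∑ j, a (x i - x j) (x i - x j) :=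
    Finset.sum_nonneg fun i _ => Finset.sum_nonneg fun j _ => hpos _
  have h2 : ∑ i, ∑ j, a (x i) (x j) = a (∑ i, x i) (∑ i, x i) := by
    simp only [map_sum, LinearMap.sum_apply]
    rw [Finset.sum_comm]
  have h3 : ∀ i j, a (x i - x j) (x i - x j) = a (x i) (x i) + a (x j) (x j) -
      2 * a (x i) (x j) := fun i j => by
    simp only [map_sub, LinearMap.sub_apply, hsymm (x j) (x i)]
    ring
  simp only [h3, Finset.sum_sub_distrib, Finset.sum_add_distrib, ← Finset.mul_sum, h2,
    Finset.sum_const, Finset.card_univ, nsmul_eq_mul] at h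
  linarith

lemma isUnit_of_bilinForm_pos [FiniteDimensional ℝ V] (b : LinearMap.BilinForm ℝ V)
    {T : Module.End ℝ V} (h : ∀ u, u ≠ 0 → 0 < b (T u) u) : IsUnit T := by
  rw [LinearMap.isUnit_iff_ker_eq_bot, LinearMap.ker_eq_bot']
  intro u hu
  by_contra hne
  have := h u hne
  simp [hu] at this

lemma apply_ringInverse_apply {T : Module.End ℝ V} (hT : IsUnit T) (u : V) :
    T (Ring.inverse T u) = u := by
  rw [← Module.End.mul_apply, Ring.mul_inverse_cancel T hT, Module.End.one_apply]

lemma ringInverse_apply_apply {T : Module.End ℝ V} (hT : IsUnit T) (u : V) :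
    Ring.inverse T (T u) = u := by
  rw [← Module.End.mul_apply, Ring.inverse_mul_cancel T hT, Module.End.one_apply]

/-- With `b` as inner product, `T` is symmetric, so it has a real eigenvalue; in finite dimension
the eigenvalues form a finite set, which has a maximum. -/
lemma exists_isGreatest_eigenvalue [FiniteDimensional ℝ V] [Nontrivial V]
    (b : LinearMap.BilinForm ℝ V) (hsymm : ∀ u v, b u v = b v u)
    (hpos : ∀ u, u ≠ 0 → 0 < b u u) {T : Module.End ℝ V} (hT : ∀ u v, b (T u) v = b u (T v)) :
    ∃ lam : ℝ, IsGreatest {μ : ℝ | Module.End.HasEigenvalue T μ} lam := by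
  let core : InnerProductSpace.Core ℝ V :=
    { inner := fun u v => b u v
      conj_inner_symm := fun u v => hsymm v u
      re_inner_nonneg := fun u => by
        by_cases hu : u = 0
        · simp [hu]
        · exact (hpos u hu).le
      add_left := fun u v w => by simp
      smul_left := fun u v r => by simp
      definite := fun u hu => by
        by_contra hne
        exact (hpos u hne).ne' hu }
  let _ : NormedAddCommGroup V := core.toNormedAddCommGroup
  let _ : InnerProductSpace ℝ V := InnerProductSpace.ofCore core.toCore
  have hsym : T.IsSymmetric := hT
  have hne : {μ : ℝ | Module.End.HasEigenvalue T μ}.Nonempty :=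
    ⟨_, hsym.hasEigenvalue_iSup_of_finiteDimensional⟩
  obtain ⟨lam, h1, h2⟩ := Set.exists_max_image _ id (Module.End.finite_hasEigenvalue T) hne
  exact ⟨lam, h1, h2⟩

end LinearAlgebra

/-! ### Symmetric positive definite operators on a finite element space -/

namespace Triangulation

variable {T : Triangulation Ω} {ΓD : Set (Pt d)} {R : Module.End ℝ (T.feSpace ΓD)}

lemma IsSPD.isUnit (hR : T.IsSPD ΓD R) : IsUnit R :=
  isUnit_of_bilinForm_pos (T.massForm ΓD) hR.2

lemma IsSPD.inverse (hR : T.IsSPD ΓD R) : T.IsSPD ΓD (Ring.inverse R) := by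
  refine ⟨fun u v => ?_, fun u hu => ?_⟩
  · have := hR.1 (Ring.inverse R u) (Ring.inverse R v)
    rw [apply_ringInverse_apply hR.isUnit, apply_ringInverse_apply hR.isUnit] at this
    exact this.symm
  · have hne : Ring.inverse R u ≠ 0 := fun h => hu (by
      rw [← apply_ringInverse_apply hR.isUnit u, h, map_zero])
    have := hR.2 _ hne
    rwa [apply_ringInverse_apply hR.isUnit, T.massForm_comm] at this

lemma IsSPD.nonneg (hR : T.IsSPD ΓD R) (u : T.feSpace ΓD) : 0 ≤ T.massForm ΓD (R u) u := by
  by_cases hu : u = 0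
  · simp [hu]
  · exact (hR.2 u hu).le

lemma isSPD_stiffness {M : ℕ} (D : Subdomains Ω M) {ω ρ : Fin M → ℝ}
    (ha : ∀ u : T.feSpace ΓD, u ≠ 0 → 0 < T.energyForm ΓD D ω ρ u u) :
    T.IsSPD ΓD (T.stiffness ΓD D ω ρ) := by
  refine ⟨fun u v => ?_, fun u hu => ?_⟩
  · rw [T.massForm_comm ΓD u, massForm_stiffness, massForm_stiffness, energyForm_comm]
  · rw [massForm_stiffness]
    exact ha u hu

end Triangulation

/-! ### The multilevel decomposition -/

namespace MeshHierarchy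

variable {L : ℕ} (𝒯 : MeshHierarchy Ω L) (ΓD : Set (Pt d))

/-- The mesh width controls the number of levels. -/
lemma levels_le_log (hd : 0 < d) {γ κ η : ℝ} (hγ0 : 0 < γ) (hγ1 : γ < 1) (hκ : 1 ≤ κ)
    (hη0 : 0 < η) (hη1 : η < 1) (hu : 𝒯.IsUniform γ κ) (hh : 𝒯.h (Fin.last L) ≤ η) :
    (L : ℝ) + 1 ≤ ((1 + 2 * Real.log κ / |Real.log η|) / |Real.log γ| + 1 / |Real.log η|) *
      |Real.log (𝒯.h (Fin.last L))| := by
  set h := 𝒯.h (Fin.last L)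
  have hh0 : 0 < h := (𝒯.mesh (Fin.last L)).meshSize_pos hd
  have hlogη := Real.log_neg hη0 hη1
  have hlogγ := Real.log_neg hγ0 hγ1
  have hlogκ := Real.log_nonneg hκ
  have hle : Real.log h ≤ Real.log η := Real.log_le_log hh0 hh
  -- The second `κ` bounds the coarsest mesh size. Taking logarithms turns this into an upper bound
  -- on `L`.
  have hb : h ≤ κ * (γ ^ L * κ) := (hu.size_upper (Fin.last L)).trans
    (by have := hu.size_coarse; simp only [Fin.val_last]; gcongr)
  have hlog : Real.log h ≤ 2 * Real.log κ + L * Real.log γ := by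
    refine (Real.log_le_log hh0 hb).trans (le_of_eq ?_)
    rw [Real.log_mul (by positivity) (by positivity), Real.log_mul (by positivity) (by positivity),
      Real.log_pow]
    ring
  rw [abs_of_neg hlogη, abs_of_neg hlogγ, abs_of_neg (hle.trans_lt hlogη)]
  set x := -Real.log h
  set y := -Real.log η
  set z := -Real.log γ
  have hy : 0 < y := neg_pos.2 hlogη
  have hz : 0 < z := neg_pos.2 hlogγ
  -- Because `h ≤ η`, the ratio `|log h| / |log η|` is at least `1`; it absorbs both the constant `2
  -- log κ` and the extra level in `L + 1`.
  have hxy : 1 ≤ x / y := (one_le_div hy).2 (neg_le_neg hle)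
  have hL : L * z ≤ x + 2 * Real.log κ := by
    simp only [x, z]
    linarith
  have h2 : (L : ℝ) ≤ (x + 2 * Real.log κ * (x / y)) / z := by
    rw [le_div_iff₀ hz]
    refine hL.trans (add_le_add_right ?_ _)
    exact le_mul_of_one_le_right (by positivity) hxy
  calc (L : ℝ) + 1 ≤ (x + 2 * Real.log κ * (x / y)) / z + x / y := add_le_add h2 hxy
    _ = _ := by
      field_simp

lemma massForm_incl (k : Fin (L + 1)) (v : 𝒯.V ΓD k) (w : 𝒯.Vh ΓD) :
    (𝒯.mesh (Fin.last L)).massForm ΓD (𝒯.incl ΓD k v) w =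
      (𝒯.mesh k).massForm ΓD v (𝒯.proj ΓD k w) := by
  rw [Triangulation.massForm_comm, ← massForm_proj, Triangulation.massForm_comm]

lemma proj_last (u : 𝒯.Vh ΓD) : 𝒯.proj ΓD (Fin.last L) u = u := by
  refine sub_eq_zero.1 (Triangulation.massForm_self_eq_zero _ ΓD _ ?_)
  rw [LinearMap.map_sub₂, sub_eq_zero]
  exact 𝒯.massForm_proj ΓD (Fin.last L) u _

variable {M : ℕ} (D : Subdomains Ω M) (ω ρ : Fin M → ℝ)

/-- The subspace solvers: the exact one on the coarsest level, the smoothers on the others. -/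
def solver (R : ∀ k : Fin (L + 1), Module.End ℝ (𝒯.V ΓD k)) (k : Fin (L + 1)) :
    Module.End ℝ (𝒯.V ΓD k) :=
  if k = 0 then Ring.inverse (𝒯.A ΓD D ω ρ k) else R k

variable (R : ∀ k : Fin (L + 1), Module.End ℝ (𝒯.V ΓD k))

lemma bpx_apply (w : 𝒯.Vh ΓD) : 𝒯.bpx ΓD D ω ρ R w =
    ∑ k, 𝒯.incl ΓD k (𝒯.solver ΓD D ω ρ R k (𝒯.proj ΓD k w)) := by
  simp only [bpx, LinearMap.sum_apply]
  rfl

/-- Inclusion and projection are adjoint, so the form of `B` splits over the levels. Both the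
definiteness of `B` and the energy bound rest on this identity. -/
lemma massForm_bpx (w v : 𝒯.Vh ΓD) :
    (𝒯.mesh (Fin.last L)).massForm ΓD (𝒯.bpx ΓD D ω ρ R w) v =
      ∑ k, (𝒯.mesh k).massForm ΓD (𝒯.solver ΓD D ω ρ R k (𝒯.proj ΓD k w)) (𝒯.proj ΓD k v) := by
  simp only [bpx_apply, map_sum, LinearMap.sum_apply, massForm_incl]

variable {D ω ρ R}

/-- All levels contribute nonnegatively; strictness comes from the finest one, where the projection
is the identity. -/
lemma isSPD_bpx (hR : ∀ k, (𝒯.mesh k).IsSPD ΓD (𝒯.solver ΓD D ω ρ R k)) :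
    (𝒯.mesh (Fin.last L)).IsSPD ΓD (𝒯.bpx ΓD D ω ρ R) := by
  refine ⟨fun u v => ?_, fun u hu => ?_⟩
  · rw [(𝒯.mesh (Fin.last L)).massForm_comm ΓD u, massForm_bpx, massForm_bpx]
    refine Finset.sum_congr rfl fun k _ => ?_
    rw [(hR k).1, Triangulation.massForm_comm]
  · rw [massForm_bpx]
    refine Finset.sum_pos' (fun k _ => (hR k).nonneg _) ⟨Fin.last L, Finset.mem_univ _, ?_⟩
    rw [proj_last]
    exact (hR (Fin.last L)).2 u hu

/-- If the energy is bounded by the solvers on every level, then it is bounded by the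
preconditioner, up to the number of levels. -/
lemma energyForm_self_le_bpx {K : ℝ} (hω : ∀ m, 0 < ω m) (hρ : ∀ m, 0 ≤ ρ m)
    (hR : ∀ k, (𝒯.mesh k).IsSPD ΓD (𝒯.solver ΓD D ω ρ R k))
    (hK : ∀ k (v : 𝒯.V ΓD k), (𝒯.mesh k).energyForm ΓD D ω ρ (𝒯.solver ΓD D ω ρ R k v)
      (𝒯.solver ΓD D ω ρ R k v) ≤ K * (𝒯.mesh k).massForm ΓD (𝒯.solver ΓD D ω ρ R k v) v)
    (u : 𝒯.Vh ΓD) : (𝒯.mesh (Fin.last L)).energyForm ΓD D ω ρ u u ≤ K * (L + 1) *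
      (𝒯.mesh (Fin.last L)).massForm ΓD (Ring.inverse (𝒯.bpx ΓD D ω ρ R) u) u := by
  have hB := 𝒯.isSPD_bpx ΓD hR
  obtain ⟨w, rfl⟩ : ∃ w, 𝒯.bpx ΓD D ω ρ R w = u := ⟨_, apply_ringInverse_apply hB.isUnit u⟩
  rw [ringInverse_apply_apply hB.isUnit, Triangulation.massForm_comm, massForm_bpx, bpx_apply]
  refine (bilinForm_sum_self_le _ ((𝒯.mesh (Fin.last L)).energyForm_comm ΓD D ω ρ)
    ((𝒯.mesh (Fin.last L)).energyForm_self_nonneg ΓD D hω hρ) _).trans ?_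
  rw [Fintype.card_fin, mul_comm K, mul_assoc, Finset.mul_sum _ _ K]
  push_cast
  refine mul_le_mul_of_nonneg_left (Finset.sum_le_sum fun k _ => ?_) (by positivity)
  exact hK k (𝒯.proj ΓD k w)

/-- The largest eigenvalue of the preconditioned operator is bounded by any constant that bounds
the energy by the preconditioner. -/
lemma exists_isGreatest_eigenvalue_bpx [Nontrivial (𝒯.Vh ΓD)] {K : ℝ}
    (hB : (𝒯.mesh (Fin.last L)).IsSPD ΓD (𝒯.bpx ΓD D ω ρ R))
    (ha : ∀ u : 𝒯.Vh ΓD, u ≠ 0 → 0 < (𝒯.mesh (Fin.last L)).energyForm ΓD D ω ρ u u)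
    (hK : ∀ u : 𝒯.Vh ΓD, (𝒯.mesh (Fin.last L)).massForm ΓD (𝒯.A ΓD D ω ρ (Fin.last L) u) u ≤
      K * (𝒯.mesh (Fin.last L)).massForm ΓD (Ring.inverse (𝒯.bpx ΓD D ω ρ R) u) u) :
    ∃ lam : ℝ, IsGreatest {μ : ℝ | Module.End.HasEigenvalue
      (𝒯.bpx ΓD D ω ρ R * 𝒯.A ΓD D ω ρ (Fin.last L)) μ} lam ∧ lam ≤ K := by
  obtain ⟨lam, hlam⟩ := exists_isGreatest_eigenvalue
    ((𝒯.mesh (Fin.last L)).energyForm ΓD D ω ρ)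
    ((𝒯.mesh (Fin.last L)).energyForm_comm ΓD D ω ρ) ha
    -- Self-adjointness in the energy form: `a(BAu, v)` and `a(u, BAv)` both equal `(BAu, Av)`, by
    -- symmetry of `a` and `B`.
    (T := 𝒯.bpx ΓD D ω ρ R * 𝒯.A ΓD D ω ρ (Fin.last L)) (fun u v => by
      rw [Triangulation.energyForm_comm, ← Triangulation.massForm_stiffness,
        ← Triangulation.massForm_stiffness, Module.End.mul_apply, Module.End.mul_apply,
        ← hB.1, Triangulation.massForm_comm])
  refine ⟨lam, hlam, ?_⟩
  obtain ⟨u, hu⟩ := hlam.1.exists_hasEigenvector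
  have h1 : 𝒯.A ΓD D ω ρ (Fin.last L) u = lam • Ring.inverse (𝒯.bpx ΓD D ω ρ R) u := by
    rw [← map_smul, ← hu.apply_eq_smul, Module.End.mul_apply, ringInverse_apply_apply hB.isUnit]
  have h2 := hK u
  rw [h1, map_smul, LinearMap.smul_apply, smul_eq_mul] at h2
  exact le_of_mul_le_mul_right h2 (hB.inverse.2 u hu.2)

end MeshHierarchy

end BPX

end

/-! ### Choice of the constants and conclusion -/

theorem lemma4p4 (d : ℕ) (hd : d = 2 ∨ d = 3) (γ κ c η : ℝ)
    (hγ0 : 0 < γ) (hγ1 : γ < 1) (hκ : 1 ≤ κ) (hc : 1 ≤ c) (hη0 : 0 < η) (hη1 : η < 1) :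
    ∃ C : ℝ, 0 < C ∧
      ∀ (Ω : BPX.PolyDomain d) (M : ℕ) (D : BPX.Subdomains Ω M) (ΓD : Set (BPX.Pt d))
        (_ : ΓD ⊆ frontier Ω.carrier)
        (L : ℕ) (𝒯 : BPX.MeshHierarchy Ω L)
        (_ : (𝒯.mesh 0).Resolves D) (_ : 𝒯.IsUniform γ κ) (_ : 𝒯.h (Fin.last L) ≤ η)
        (ω ρ : Fin M → ℝ) (_ : ∀ m, 0 < ω m) (_ : ∀ m, 0 ≤ ρ m)
        (_ : (∃ m, 0 < ρ m) ∨
          MeasureTheory.Measure.hausdorffMeasure ((d : ℝ) - 1) ΓD ≠ 0)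
        (R : ∀ k : Fin (L + 1), Module.End ℝ (𝒯.V ΓD k)) (_ : 𝒯.IsSmoother ΓD D ω ρ c R),
        IsUnit (𝒯.bpx ΓD D ω ρ R) ∧
        (∀ u : 𝒯.Vh ΓD,
          (𝒯.mesh (Fin.last L)).massForm ΓD (𝒯.A ΓD D ω ρ (Fin.last L) u) u ≤
            C * |Real.log (𝒯.h (Fin.last L))| *
              (𝒯.mesh (Fin.last L)).massForm ΓD (Ring.inverse (𝒯.bpx ΓD D ω ρ R) u) u) ∧
        (Nontrivial (𝒯.Vh ΓD) →
          ∃ lam : ℝ,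
            IsGreatest {μ : ℝ | Module.End.HasEigenvalue
              (𝒯.bpx ΓD D ω ρ R * 𝒯.A ΓD D ω ρ (Fin.last L)) μ} lam ∧
            lam ≤ C * |Real.log (𝒯.h (Fin.last L))|) := by
  have hd0 : 0 < d := by omega
  -- `N` is the factor between the number of levels and `|log h|`; `K` below is the inverse
  -- inequality constant times the smoother constant `c`.
  set N := (1 + 2 * Real.log κ / |Real.log η|) / |Real.log γ| + 1 / |Real.log η| with hN
  set K := 16 * κ ^ 2 * (4 * κ) ^ d * c with hK
  have hlogη : 0 < |Real.log η| := abs_pos.2 (Real.log_neg hη0 hη1).ne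
  have hlogγ : 0 < |Real.log γ| := abs_pos.2 (Real.log_neg hγ0 hγ1).ne
  have hlogκ := Real.log_nonneg hκ
  have hN0 : 0 < N := by positivity
  have hK1 : 1 ≤ K := by
    have h1 : 1 ≤ κ ^ 2 := one_le_pow₀ hκ
    have h2 : 1 ≤ (4 * κ) ^ d := one_le_pow₀ (by linarith)
    exact one_le_mul_of_one_le_of_one_le
      (one_le_mul_of_one_le_of_one_le (by linarith) h2) hc
  refine ⟨K * N, by positivity, ?_⟩
  intro Ω M D ΓD hΓ L 𝒯 hres huni hh ω ρ hω hρ hcoer R hR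
  have ha : ∀ k (u : 𝒯.V ΓD k), u ≠ 0 → 0 < (𝒯.mesh k).energyForm ΓD D ω ρ u u :=
    fun k u hu => (𝒯.mesh k).energyForm_self_pos ΓD D hΓ hω hρ hcoer hu
  have hA : ∀ k, (𝒯.mesh k).IsSPD ΓD (𝒯.A ΓD D ω ρ k) := fun k =>
    BPX.Triangulation.isSPD_stiffness D (ha k)
  have hS : ∀ k, (𝒯.mesh k).IsSPD ΓD (𝒯.solver ΓD D ω ρ R k) := by
    intro k
    unfold BPX.MeshHierarchy.solver
    split_ifs with hk
    · exact (hA k).inverse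
    · exact (hR k hk).1
  have hKS : ∀ k (v : 𝒯.V ΓD k), (𝒯.mesh k).energyForm ΓD D ω ρ (𝒯.solver ΓD D ω ρ R k v)
      (𝒯.solver ΓD D ω ρ R k v) ≤ K * (𝒯.mesh k).massForm ΓD (𝒯.solver ΓD D ω ρ R k v) v := by
    intro k v
    have hnn := (hS k).nonneg v
    unfold BPX.MeshHierarchy.solver at hnn ⊢
    split_ifs at hnn ⊢ with hk
    -- Coarsest level: with `x = A_0⁻¹ v`, `a(x, x) = (v, x)` exactly, so `1 ≤ K` suffices.
    · rw [← BPX.Triangulation.massForm_stiffness, BPX.apply_ringInverse_apply (hA k).isUnit,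
        BPX.Triangulation.massForm_comm]
      exact le_mul_of_one_le_left hnn hK1
    · refine ((𝒯.mesh k).energyForm_self_le ΓD D hd0 hκ (huni.quasiUniform k) hres
        (𝒯.nested 0 k (Fin.zero_le k)) hω hρ _).trans ?_
      -- The lower smoother bound at `x = R_k v`, where `(R_k⁻¹ x, x) = (v, R_k v)`.
      have h1 := ((hR k hk).2 (R k v)).1
      rw [BPX.ringInverse_apply_apply (hR k hk).1.isUnit, inv_mul_le_iff₀ (by linarith),
        BPX.Triangulation.massForm_comm] at h1
      rw [hK, mul_assoc _ c]
      exact mul_le_mul_of_nonneg_left h1 (by positivity)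
  have hB := 𝒯.isSPD_bpx ΓD hS
  have hmain : ∀ u : 𝒯.Vh ΓD,
      (𝒯.mesh (Fin.last L)).massForm ΓD (𝒯.A ΓD D ω ρ (Fin.last L) u) u ≤
        K * N * |Real.log (𝒯.h (Fin.last L))| *
          (𝒯.mesh (Fin.last L)).massForm ΓD (Ring.inverse (𝒯.bpx ΓD D ω ρ R) u) u := by
    intro u
    rw [BPX.Triangulation.massForm_stiffness]
    refine (𝒯.energyForm_self_le_bpx ΓD hω hρ hS hKS u).trans
      (mul_le_mul_of_nonneg_right ?_ (hB.inverse.nonneg u))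
    rw [mul_assoc K N]
    exact mul_le_mul_of_nonneg_left
      (𝒯.levels_le_log hd0 hγ0 hγ1 hκ hη0 hη1 huni hh) (by positivity)
  refine ⟨hB.isUnit, hmain, fun _ => ?_⟩
  exact 𝒯.exists_isGreatest_eigenvalue_bpx ΓD hB (ha _) hmain
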